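/- Fix a finite nonempty set $AP$ of atomic propositions. LTL formulae are generated by $\varphi ::= \bot \mid p \mid \lnot\varphi \mid \varphi\lor\varphi \mid \mathsf{X}\varphi \mid \varphi\,\mathsf{U}\,\varphi$ ($p\in AP$) and interpreted as usual on traces $\pi\in(2^{AP})^\omega$; let $\mathrm{Fm}$ be the set of all of them. A Kripke structure (finite set of states, nonempty set of initial states, left-total transition relation, states labelled by subsets of $AP$) satisfies a formula iff all its traces do, and $\mathrm{Cn}(X)$, for $X\subseteq\mathrm{Fm}$, is the set of formulae satisfied by every Kripke structure that satisfies all formulae of $X$. A formula $\varphi$ is a tautology if $\varphi\in\mathrm{Cn}(\emptyset)$; write $\varphi\equiv\psi$ if $\mathrm{Cn}(\{\varphi\})=\mathrm{Cn}(\{\psi\})$. For a Büchi automaton $A$ over the alphabet $2^{AP}$ with accepted language $L(A)$, let $\mathrm{supp}(A)=\{\varphi\in\mathrm{Fm} : \pi\models\varphi\text{ for all }\pi\in L(A)\}$. The Büchi excerpt is the set of all theories of the form $\mathrm{supp}(A)$, with $A$ a Büchi automaton over $2^{AP}$. A Büchi choice function is a map $\gamma$ from LTL formulae to Büchi automata over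 $2^{AP}$ such that for all $\varphi,\psi\in\mathrm{Fm}$: $L(\gamma(\varphi))\neq\emptyset$; if $\varphi$ is not a tautology then $\lnot\varphi\in\mathrm{supp}(\gamma(\varphi))$; and if $\varphi\equiv\psi$ then $L(\gamma(\varphi))=L(\gamma(\psi))$. **Theorem.** Let $K$ be a theory in the Büchi excerpt and let $\varphi\mapsto K\ominus\varphi$ be a function from $\mathrm{Fm}$ to $2^{\mathrm{Fm}}$. The following are equivalent. 1. $\ominus$ is a rational contraction function on $K$, i.e. for all $\varphi,\psi\in\mathrm{Fm}$: $K\ominus\varphi=\mathrm{Cn}(K\ominus\varphi)$; $K\ominus\varphi\subseteq K$; if $\varphi\notin K$ then $K\ominus\varphi=K$; if $\varphi$ is not a tautology then $\varphi\notin K\ominus\varphi$; $K\subseteq\mathrm{Cn}((K\ominus\varphi)\cup\{\varphi\})$; if $\varphi\equiv\psi$ then $K\ominus\varphi=K\ominus\psi$; and moreover $\ominus$ remains in the Büchi excerpt, i.e. $K\ominus\varphi$ belongs to the Büchi excerpt for every $\varphi\in\mathrm{Fm}$. 2. $\ominus$ is a Büchi Contraction Function on $K$, i.e. there is a Büchi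 choice function $\gamma$ such that for all $\varphi\in\mathrm{Fm}$, $K\ominus\varphi=K\cap\mathrm{supp}(\gamma(\varphi))$ if $\varphi$ is not a tautology and $\varphi\in K$, and $K\ominus\varphi=K$ otherwise. -/

import Mathlib

namespace BuchiLTL

universe u

/-- Formulae of linear temporal logic over the atomic propositions `AP`. -/
inductive Formula (AP : Type u) : Type u
  | falsum : Formula AP
  | atom : AP → Formula AP
  | neg : Formula AP → Formula AP
  | or : Formula AP → Formula AP → Formula AP
  | next : Formula AP → Formula AP
  | untl : Formula AP → Formula AP → Formula AP

/-- A trace: an infinite sequence of sets of atomic propositions. -/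
abbrev Trace (AP : Type u) : Type u := ℕ → Set AP

/-- The suffix `π^i` of a trace. -/
def Trace.suffix {AP : Type u} (π : Trace AP) (i : ℕ) : Trace AP := fun n => π (i + n)

/-- `Sat φ π`: the trace `π` satisfies the formula `φ`. -/
def Sat {AP : Type u} : Formula AP → Trace AP → Prop
  | .falsum, _ => False
  | .atom p, π => p ∈ π 0
  | .neg φ, π => ¬ Sat φ π
  | .or φ ψ, π => Sat φ π ∨ Sat ψ π
  | .next φ, π => Sat φ (π.suffix 1)
  | .untl φ ψ, π => ∃ i : ℕ, Sat ψ (π.suffix i) ∧ ∀ j < i, Sat φ (π.suffix j)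

/-- A Kripke structure: finitely many states, a nonempty set of initial states, a left-total
transition relation, and a labelling of the states by sets of atomic propositions. -/
structure KripkeStructure (AP : Type u) where
  State : Type
  finite_state : Finite State
  init : Set State
  init_nonempty : init.Nonempty
  trans : State → State → Prop
  trans_total : ∀ s, ∃ s', trans s s'
  label : State → Set AP

namespace KripkeStructure

/-- The traces of a Kripke structure. -/
def traces {AP : Type u} (M : KripkeStructure AP) : Set (Trace AP) :=
  {π | ∃ s : ℕ → M.State, s 0 ∈ M.init ∧ (∀ i, M.trans (s i) (s (i + 1))) ∧
    ∀ i, π i = M.label (s i)}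

/-- `M ⊨ φ`: all traces of `M` satisfy `φ`. -/
def Models {AP : Type u} (M : KripkeStructure AP) (φ : Formula AP) : Prop :=
  ∀ π ∈ M.traces, Sat φ π

/-- `M ⊨ X`: `M` satisfies every formula of `X`. -/
def ModelsSet {AP : Type u} (M : KripkeStructure AP) (X : Set (Formula AP)) : Prop :=
  ∀ φ ∈ X, M.Models φ

end KripkeStructure

/-- The consequence operator of LTL. -/
def Cn {AP : Type u} (X : Set (Formula AP)) : Set (Formula AP) :=
  {ψ | ∀ M : KripkeStructure AP, M.ModelsSet X → M.Models ψ}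

/-- A formula is a tautology if it lies in `Cn ∅`. -/
def IsTautology {AP : Type u} (φ : Formula AP) : Prop := φ ∈ Cn (∅ : Set (Formula AP))

/-- Logical equivalence of formulae: equal sets of consequences. -/
def Equivalent {AP : Type u} (φ ψ : Formula AP) : Prop := Cn {φ} = Cn {ψ}

/-- The expansion `K + φ = Cn (K ∪ {φ})`. -/
def expansion {AP : Type u} (K : Set (Formula AP)) (φ : Formula AP) : Set (Formula AP) :=
  Cn (K ∪ {φ})

/-- A (nondeterministic, finite-state) Büchi automaton over the alphabet `A`. -/
structure BuchiAutomaton (A : Type u) where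
  State : Type
  finite_state : Finite State
  trans : Set (State × A × State)
  init : Set State
  recurrent : Set State

/-- The infinite words for which some run from an initial state visits recurrence states
infinitely often. -/
def BuchiAutomaton.language {A : Type u} (B : BuchiAutomaton A) : Set (ℕ → A) :=
  {w | ∃ q : ℕ → B.State, q 0 ∈ B.init ∧ (∀ i, (q i, w i, q (i + 1)) ∈ B.trans) ∧
    {i | q i ∈ B.recurrent}.Infinite}

/-- The support of a Büchi automaton over the alphabet of sets of atomic propositions: the
formulae satisfied by all accepted traces. -/
def support {AP : Type u} (B : BuchiAutomaton (Set AP)) : Set (Formula AP) :=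
  {φ | ∀ π ∈ B.language, Sat φ π}

/-- The Büchi excerpt: the theories that are the support of some Büchi automaton. -/
def buchiExcerpt (AP : Type u) : Set (Set (Formula AP)) :=
  Set.range (support (AP := AP))

/-- The basic rationality postulates for a function `c`, where `c φ` is the result of
contracting `φ` from `K`. -/
structure IsRationalContraction {AP : Type u} (K : Set (Formula AP))
    (c : Formula AP → Set (Formula AP)) : Prop where
  closure : ∀ φ, c φ = Cn (c φ)
  inclusion : ∀ φ, c φ ⊆ K
  vacuity : ∀ φ, φ ∉ K → c φ = K
  success : ∀ φ, ¬ IsTautology φ → φ ∉ c φ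
  recovery : ∀ φ, K ⊆ expansion (c φ) φ
  extensionality : ∀ φ ψ, Equivalent φ ψ → c φ = c ψ

/-- The function `c` remains in the excerpt `E`. -/
def RemainsIn {AP : Type u} (c : Formula AP → Set (Formula AP))
    (E : Set (Set (Formula AP))) : Prop :=
  Set.range c ⊆ E

/-- Büchi choice functions. -/
structure IsBuchiChoiceFunction {AP : Type u}
    (γ : Formula AP → BuchiAutomaton (Set AP)) : Prop where
  nonempty : ∀ φ, (γ φ).language.Nonempty
  supports_neg : ∀ φ, ¬ IsTautology φ → φ.neg ∈ support (γ φ)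
  extensional : ∀ φ ψ, Equivalent φ ψ → (γ φ).language = (γ ψ).language

open Classical in
/-- The function on `K` induced by `γ`. -/
noncomputable def inducedContraction {AP : Type u} (K : Set (Formula AP))
    (γ : Formula AP → BuchiAutomaton (Set AP)) (φ : Formula AP) : Set (Formula AP) :=
  if ¬ IsTautology φ ∧ φ ∈ K then K ∩ support (γ φ) else K

/-- `c` is a Büchi Contraction Function on `K`. -/
def IsBuchiContractionFunction {AP : Type u} (K : Set (Formula AP))
    (c : Formula AP → Set (Formula AP)) : Prop :=
  ∃ γ : Formula AP → BuchiAutomaton (Set AP),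
    IsBuchiChoiceFunction γ ∧ c = inducedContraction K γ

end BuchiLTL

/-! Everything turns on comparing `Cn`, defined through Kripke structures, with satisfaction on
single traces. A tableau makes the traces of a Büchi language that satisfy a formula Büchi again,
and a nonempty Büchi language contains all traces of some lasso-shaped Kripke structure. So a
trace-level counterexample yields a Kripke counterexample: supports are closed under `Cn`, and any
consequence of `support B ∪ {φ}` holds on each trace of `B` satisfying `φ` (`sat_of_mem_Cn_union`).

From a rational contraction, write `c φ` as a support and let `γ φ` accept the traces of that
automaton violating `φ`. Success makes this nonempty. A formula of `K` that holds on `γ φ` also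
holds on the remaining traces, by recovery, so it lies in `c φ`.

Conversely, the support of a union is the intersection of supports, so induced contractions stay in
the excerpt; recovery holds because `¬φ ∨ χ` survives the contraction for each `χ ∈ K`. -/

namespace BuchiLTL

open Filter

/-! ### Büchi automata: generalized acceptance and unions -/

section Automata

universe v w

/-- The automaton step that records which acceptance sets were visited since the last reset. -/
def visitedStep {S : Type v} {ι : Type w} (F : ι → Set S) (R : Set ι) (s : S) : Set ι :=
  {k | (k ∈ R ∧ R ≠ Set.univ) ∨ s ∈ F k}

/-- The acceptance sets visited since the last reset along `q`. -/
def visited {S : Type v} {ι : Type w} (F : ι → Set S) (q : ℕ → S) : ℕ → Set ι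
  | 0 => ∅
  | n + 1 => visitedStep F (visited F q n) (q n)

/-- If the record were never full after `N`, it would never be reset, so indices would accumulate;
as `ι` is finite, all are collected by a bounded time. -/
theorem frequently_full_of_frequently {S : Type v} {ι : Type w} [Finite ι] {F : ι → Set S}
    {q : ℕ → S} {R : ℕ → Set ι} (hR : ∀ n, R (n + 1) = visitedStep F (R n) (q n))
    (h : ∀ k, ∃ᶠ i in atTop, q i ∈ F k) : ∃ᶠ i in atTop, R i = Set.univ := by
  rw [frequently_atTop]
  intro N
  by_contra! hN
  have persist : ∀ k n, N ≤ n → k ∈ R n → ∀ d, k ∈ R (n + d) := by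
    intro k n hn hk d
    induction d with
    | zero => exact hk
    | succ d ih =>
      rw [← add_assoc, hR]
      exact Or.inl ⟨ih, hN _ (by omega)⟩
  have hv : ∀ k, ∃ n, N ≤ n ∧ q n ∈ F k := fun k => frequently_atTop.1 (h k) N
  choose f hf hfF using hv
  obtain ⟨m, hm⟩ := (Set.finite_range f).bddAbove
  refine hN (N + m + 1) (by omega) (Set.eq_univ_of_forall fun k => ?_)
  have hk : k ∈ R (f k + 1) := by
    rw [hR]
    exact Or.inr (hfF k)
  have hle : f k ≤ m := hm ⟨k, rfl⟩
  have := persist k (f k + 1) (by have := hf k; omega) hk (N + m - f k)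
  rwa [show f k + 1 + (N + m - f k) = N + m + 1 by omega] at this

/-- A full record is cleared at the next step, so between two full moments every acceptance set is
visited anew. -/
theorem frequently_of_frequently_full {S : Type v} {ι : Type w} {F : ι → Set S}
    {q : ℕ → S} {R : ℕ → Set ι} (hR : ∀ n, R (n + 1) = visitedStep F (R n) (q n))
    (h : ∃ᶠ i in atTop, R i = Set.univ) (k : ι) : ∃ᶠ i in atTop, q i ∈ F k := by
  rw [frequently_atTop] at h ⊢
  intro N
  obtain ⟨n, hn, hRn⟩ := h N
  obtain ⟨m, hm, hRm⟩ := h (n + 1)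
  have key : ∀ d, k ∈ R (n + 1 + d) → ∃ i ≥ n, q i ∈ F k := by
    intro d
    induction d with
    | zero =>
      intro hk
      rw [add_zero, hR] at hk
      rcases hk with hk | hk
      · exact absurd hRn hk.2
      · exact ⟨n, le_rfl, hk⟩
    | succ d ih =>
      intro hk
      rw [← add_assoc, hR] at hk
      rcases hk with hk | hk
      · exact ih hk.1
      · exact ⟨_, by omega, hk⟩
  obtain ⟨i, hi, hik⟩ := key (m - (n + 1)) (by
    rw [Nat.add_sub_cancel' hm, hRm]; trivial)
  exact ⟨i, by omega, hik⟩

/-- Generalized Büchi acceptance over a finite state space of any universe can be reduced to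
Büchi acceptance. -/
theorem exists_buchiAutomaton_of_generalized {A : Type u} {S : Type v} {ι : Type w} [Finite S]
    [Finite ι] (tr : S → A → S → Prop) (I : Set S) (F : ι → Set S) :
    ∃ C : BuchiAutomaton A, ∀ x, x ∈ C.language ↔ ∃ q : ℕ → S, q 0 ∈ I ∧
      (∀ i, tr (q i) (x i) (q (i + 1))) ∧ ∀ k, ∃ᶠ i in atTop, q i ∈ F k := by
  obtain ⟨n, ⟨e⟩⟩ := Finite.exists_equiv_fin (S × Set ι)
  refine ⟨{
    State := Fin n
    finite_state := inferInstance
    trans := {t | tr (e.symm t.1).1 t.2.1 (e.symm t.2.2).1 ∧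
      (e.symm t.2.2).2 = visitedStep F (e.symm t.1).2 (e.symm t.1).1}
    -- The initial record is unconstrained: acceptance depends only on what happens infinitely
    -- often.
    init := {s | (e.symm s).1 ∈ I}
    recurrent := {s | (e.symm s).2 = Set.univ} }, fun x => ⟨?_, ?_⟩⟩
  · rintro ⟨q, h0, ht, hr⟩
    refine ⟨fun i => (e.symm (q i)).1, h0, fun i => (ht i).1, fun k => ?_⟩
    exact frequently_of_frequently_full (R := fun i => (e.symm (q i)).2) (fun i => (ht i).2)
      (Nat.frequently_atTop_iff_infinite.2 hr) k
  · rintro ⟨q, h0, ht, hr⟩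
    refine ⟨fun i => e (q i, visited F q i), ?_, fun i => ?_, ?_⟩
    · simpa using h0
    · simpa using ⟨ht i, rfl⟩
    · have := Nat.frequently_atTop_iff_infinite.1
        (frequently_full_of_frequently (R := visited F q) (fun _ => rfl) hr)
      simpa using this

theorem exists_buchiAutomaton_union {A : Type u} (B C : BuchiAutomaton A) :
    ∃ D : BuchiAutomaton A, D.language = B.language ∪ C.language := by
  have := B.finite_state
  have := C.finite_state
  refine ⟨{
    State := B.State ⊕ C.State
    finite_state := inferInstance
    trans := {t | (∃ s s', t.1 = .inl s ∧ t.2.2 = .inl s' ∧ (s, t.2.1, s') ∈ B.trans) ∨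
      (∃ s s', t.1 = .inr s ∧ t.2.2 = .inr s' ∧ (s, t.2.1, s') ∈ C.trans)}
    init := Sum.inl '' B.init ∪ Sum.inr '' C.init
    recurrent := Sum.inl '' B.recurrent ∪ Sum.inr '' C.recurrent }, ?_⟩
  ext x
  constructor
  · rintro ⟨q, h0, ht, hr⟩
    rcases h0 with ⟨s, hs, hs0⟩ | ⟨s, hs, hs0⟩
    · left
      have hl : ∀ i, ∃ s, q i = .inl s := by
        intro i
        induction i with
        | zero => exact ⟨s, hs0.symm⟩
        | succ i ih =>
          obtain ⟨s, hs⟩ := ih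
          rcases ht i with ⟨_, s', -, h, -⟩ | ⟨_, _, h, -⟩
          · exact ⟨s', h⟩
          · simp [hs] at h
      choose p hp using hl
      refine ⟨p, ?_, fun i => ?_, ?_⟩
      · have : s = p 0 := Sum.inl_injective (hs0.trans (hp 0))
        rwa [← this]
      · have := ht i
        simpa [hp] using this
      · simpa [hp] using hr
    · right
      have hl : ∀ i, ∃ s, q i = .inr s := by
        intro i
        induction i with
        | zero => exact ⟨s, hs0.symm⟩
        | succ i ih =>
          obtain ⟨s, hs⟩ := ih
          rcases ht i with ⟨_, _, h, -⟩ | ⟨_, s', -, h, -⟩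
          · simp [hs] at h
          · exact ⟨s', h⟩
      choose p hp using hl
      refine ⟨p, ?_, fun i => ?_, ?_⟩
      · have : s = p 0 := Sum.inr_injective (hs0.trans (hp 0))
        rwa [← this]
      · have := ht i
        simpa [hp] using this
      · simpa [hp] using hr
  · rintro (⟨q, h0, ht, hr⟩ | ⟨q, h0, ht, hr⟩)
    · refine ⟨fun i => .inl (q i), ?_, fun i => ?_, ?_⟩
      · simpa using h0
      · simpa using ht i
      · simpa using hr
    · refine ⟨fun i => .inr (q i), ?_, fun i => ?_, ?_⟩
      · simpa using h0
      · simpa using ht i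
      · simpa using hr

theorem exists_buchiAutomaton_univ (A : Type u) :
    ∃ B : BuchiAutomaton A, B.language = Set.univ := by
  refine ⟨{
    State := Unit
    finite_state := inferInstance
    trans := Set.univ
    init := Set.univ
    recurrent := Set.univ }, Set.eq_univ_of_forall fun x => ?_⟩
  exact ⟨fun _ => (), trivial, fun _ => trivial, by simpa using Set.infinite_univ⟩

end Automata

/-! ### Tableau construction for LTL formulae -/

section Tableau

variable {AP : Type u}

/-- The set of subformulae of a formula. -/
def subformulae : Formula AP → Set (Formula AP)
  | .falsum => {.falsum}
  | .atom p => {.atom p}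
  | .neg φ => insert (.neg φ) (subformulae φ)
  | .or φ ψ => insert (.or φ ψ) (subformulae φ ∪ subformulae ψ)
  | .next φ => insert (.next φ) (subformulae φ)
  | .untl φ ψ => insert (.untl φ ψ) (subformulae φ ∪ subformulae ψ)

theorem subformulae_finite (φ : Formula AP) : (subformulae φ).Finite := by
  induction φ with
  | falsum => exact Set.finite_singleton _
  | atom p => exact Set.finite_singleton _
  | neg φ ih => exact ih.insert _
  | or φ ψ ih₁ ih₂ => exact (ih₁.union ih₂).insert _
  | next φ ih => exact ih.insert _
  | untl φ ψ ih₁ ih₂ => exact (ih₁.union ih₂).insert _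

theorem self_mem_subformulae (φ : Formula AP) : φ ∈ subformulae φ := by
  cases φ <;> simp [subformulae]

theorem subformulae_subset {φ χ : Formula AP} (h : χ ∈ subformulae φ) :
    subformulae χ ⊆ subformulae φ := by
  induction φ with
  | falsum => rw [show χ = _ from h]
  | atom p => rw [show χ = _ from h]
  | neg φ ih | next φ ih =>
    rcases h with rfl | h
    · exact subset_rfl
    · exact (ih h).trans (Set.subset_insert _ _)
  | or φ ψ ih₁ ih₂ | untl φ ψ ih₁ ih₂ =>
    rcases h with rfl | h | h
    · exact subset_rfl
    · exact (ih₁ h).trans (Set.subset_union_left.trans (Set.subset_insert _ _))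
    · exact (ih₂ h).trans (Set.subset_union_right.trans (Set.subset_insert _ _))

/-- Membership of the given formula in `T` agrees with the one-step expansion of its semantics,
where `T` and `T'` hold the formulae true now and at the next position. -/
def LocallyConsistent (T : Set (Formula AP)) (a : Set AP) (T' : Set (Formula AP)) :
    Formula AP → Prop
  | .falsum => .falsum ∉ T
  | .atom p => .atom p ∈ T ↔ p ∈ a
  | .neg φ => .neg φ ∈ T ↔ φ ∉ T
  | .or φ ψ => .or φ ψ ∈ T ↔ φ ∈ T ∨ ψ ∈ T
  | .next φ => .next φ ∈ T ↔ φ ∈ T'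
  | .untl φ ψ => .untl φ ψ ∈ T ↔ ψ ∈ T ∨ (φ ∈ T ∧ .untl φ ψ ∈ T')

/-- `T` has no pending obligation for the given formula. -/
def Fulfilled (T : Set (Formula AP)) : Formula AP → Prop
  | .untl φ ψ => .untl φ ψ ∈ T → ψ ∈ T
  | _ => True

theorem Trace.suffix_suffix (π : Trace AP) (i j : ℕ) :
    (π.suffix i).suffix j = π.suffix (i + j) := by
  funext n
  simp [Trace.suffix, add_assoc]

theorem Trace.suffix_zero (π : Trace AP) : π.suffix 0 = π := by
  funext n
  simp [Trace.suffix]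

theorem sat_untl_iff (φ ψ : Formula AP) (π : Trace AP) :
    Sat (.untl φ ψ) π ↔ Sat ψ π ∨ (Sat φ π ∧ Sat (.untl φ ψ) (π.suffix 1)) := by
  constructor
  · rintro ⟨_ | i, hi, hj⟩
    · exact Or.inl (by rwa [Trace.suffix_zero] at hi)
    · refine Or.inr ⟨by simpa only [Trace.suffix_zero] using hj 0 (by omega), i, ?_, fun j hji => ?_⟩
      · rwa [Trace.suffix_suffix, add_comm]
      · rw [Trace.suffix_suffix, add_comm]
        exact hj _ (by omega)
  · rintro (h | ⟨h, i, hi, hj⟩)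
    · exact ⟨0, by rwa [Trace.suffix_zero], fun j hj => absurd hj (Nat.not_lt_zero j)⟩
    · refine ⟨i + 1, by rwa [Trace.suffix_suffix, add_comm] at hi, fun j hji => ?_⟩
      rcases j with _ | j
      · rwa [Trace.suffix_zero]
      · have := hj j (by omega)
        rwa [Trace.suffix_suffix, add_comm] at this

/-- Local consistency forces the semantics except that an until could be postponed forever;
recurring fulfilment excludes this. -/
theorem mem_iff_sat_of_locallyConsistent {Γ : Set (Formula AP)} {π : Trace AP}
    {T : ℕ → Set (Formula AP)}
    (hT : ∀ i, ∀ χ ∈ Γ, LocallyConsistent (T i) (π i) (T (i + 1)) χ)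
    (hF : ∀ χ ∈ Γ, ∃ᶠ i in atTop, Fulfilled (T i) χ) (φ : Formula AP) (hφ : subformulae φ ⊆ Γ)
    (i : ℕ) : φ ∈ T i ↔ Sat φ (π.suffix i) := by
  induction φ generalizing i with
  | falsum =>
    have := hT i _ (hφ (self_mem_subformulae _))
    simpa [LocallyConsistent, Sat] using this
  | atom p =>
    have := hT i _ (hφ (self_mem_subformulae _))
    simpa [LocallyConsistent, Sat, Trace.suffix] using this
  | neg φ ih =>
    have := hT i _ (hφ (self_mem_subformulae _))
    rw [LocallyConsistent, ih ((Set.subset_insert _ _).trans hφ)] at this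
    exact this
  | or φ ψ ih₁ ih₂ =>
    have := hT i _ (hφ (self_mem_subformulae _))
    have hs := (Set.subset_insert _ _).trans hφ
    rw [LocallyConsistent, ih₁ (Set.subset_union_left.trans hs),
      ih₂ (Set.subset_union_right.trans hs)] at this
    exact this
  | next φ ih =>
    have := hT i _ (hφ (self_mem_subformulae _))
    rw [LocallyConsistent, ih ((Set.subset_insert _ _).trans hφ)] at this
    rw [this, Sat, Trace.suffix_suffix]
  | untl φ ψ ih₁ ih₂ =>
    have hmem := hφ (self_mem_subformulae _)
    have hs := (Set.subset_insert _ _).trans hφ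
    have step : ∀ i, .untl φ ψ ∈ T i ↔
        Sat ψ (π.suffix i) ∨ (Sat φ (π.suffix i) ∧ .untl φ ψ ∈ T (i + 1)) := by
      intro i
      have := hT i _ hmem
      rwa [LocallyConsistent, ih₁ (Set.subset_union_left.trans hs),
        ih₂ (Set.subset_union_right.trans hs)] at this
    have sstep : ∀ i, Sat (.untl φ ψ) (π.suffix i) ↔
        Sat ψ (π.suffix i) ∨ (Sat φ (π.suffix i) ∧ Sat (.untl φ ψ) (π.suffix (i + 1))) := by
      intro i
      rw [sat_untl_iff, Trace.suffix_suffix]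
    constructor
    · intro h
      by_contra hn
      -- A spurious until propagates forever, contradicting the next moment at which it is
      -- fulfilled.
      have all : ∀ d, .untl φ ψ ∈ T (i + d) ∧ ¬ Sat (.untl φ ψ) (π.suffix (i + d)) := by
        intro d
        induction d with
        | zero => exact ⟨h, hn⟩
        | succ d ih =>
          have h₁ := step (i + d)
          have h₂ := sstep (i + d)
          rw [← add_assoc]
          tauto
      obtain ⟨n, hn, hf⟩ := frequently_atTop.1 (hF _ hmem) i
      obtain ⟨h₁, h₂⟩ := all (n - i)
      rw [Nat.add_sub_cancel' hn] at h₁ h₂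
      exact h₂ ((sstep n).2 (Or.inl ((ih₂ (Set.subset_union_right.trans hs) n).1 (hf h₁))))
    · rintro ⟨n, hn, hj⟩
      rw [Trace.suffix_suffix] at hn
      have back : ∀ d ≤ n, .untl φ ψ ∈ T (i + (n - d)) := by
        intro d
        induction d with
        | zero => exact fun _ => (step _).2 (Or.inl hn)
        | succ d ih =>
          intro hd
          refine (step _).2 (Or.inr ⟨?_, ?_⟩)
          · have := hj (n - (d + 1)) (by omega)
            rwa [Trace.suffix_suffix] at this
          · have := ih (by omega)
            rwa [show i + (n - (d + 1)) + 1 = i + (n - d) by omega]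
      simpa using back n le_rfl

/-- Completeness of the tableau: the subformulae actually true along `π` form a run. -/
theorem locallyConsistent_sat (π : Trace AP) {φ χ : Formula AP} (hχ : χ ∈ subformulae φ)
    (i : ℕ) :
    LocallyConsistent {θ | θ ∈ subformulae φ ∧ Sat θ (π.suffix i)} (π i)
      {θ | θ ∈ subformulae φ ∧ Sat θ (π.suffix (i + 1))} χ := by
  have hs := subformulae_subset hχ
  have mem : ∀ θ, θ ∈ subformulae χ → θ ∈ subformulae φ := fun θ hθ => hs hθ
  cases χ with
  | falsum => simp [LocallyConsistent, Sat]
  | atom p => simp [LocallyConsistent, Sat, hχ, Trace.suffix]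
  | neg χ =>
    have := mem χ (by simp [subformulae, self_mem_subformulae])
    simp [LocallyConsistent, Sat, hχ, this]
  | or χ θ =>
    have h₁ := mem χ (by simp [subformulae, self_mem_subformulae])
    have h₂ := mem θ (by simp [subformulae, self_mem_subformulae])
    simp [LocallyConsistent, Sat, hχ, h₁, h₂]
  | next χ =>
    have := mem χ (by simp [subformulae, self_mem_subformulae])
    simp [LocallyConsistent, Sat, hχ, this, Trace.suffix_suffix]
  | untl χ θ =>
    have h₁ := mem χ (by simp [subformulae, self_mem_subformulae])
    have h₂ := mem θ (by simp [subformulae, self_mem_subformulae])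
    have h₃ := sat_untl_iff χ θ (π.suffix i)
    rw [Trace.suffix_suffix] at h₃
    simpa [LocallyConsistent, hχ, h₁, h₂] using h₃

theorem frequently_fulfilled_sat (π : Trace AP) {φ χ : Formula AP} (hχ : χ ∈ subformulae φ) :
    ∃ᶠ i in atTop, Fulfilled {θ | θ ∈ subformulae φ ∧ Sat θ (π.suffix i)} χ := by
  rw [frequently_atTop]
  intro N
  cases χ with
  | untl χ θ =>
    have hθ : θ ∈ subformulae φ :=
      subformulae_subset hχ (by simp [subformulae, self_mem_subformulae])
    by_cases h : Sat (.untl χ θ) (π.suffix N)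
    · obtain ⟨i, hi, -⟩ := h
      rw [Trace.suffix_suffix] at hi
      exact ⟨N + i, by omega, fun _ => ⟨hθ, hi⟩⟩
    · exact ⟨N, le_rfl, fun hN => absurd hN.2 h⟩
  | _ => exact ⟨N, le_rfl, trivial⟩

/-- The words accepted by a Büchi automaton that satisfy a formula form a Büchi language. -/
theorem exists_buchiAutomaton_inter_sat (B : BuchiAutomaton (Set AP)) (φ : Formula AP) :
    ∃ C : BuchiAutomaton (Set AP), ∀ π, π ∈ C.language ↔ π ∈ B.language ∧ Sat φ π := by
  have := B.finite_state
  have hfin := subformulae_finite φ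
  have : Finite (subformulae φ) := hfin
  have : Finite (𝒫 (subformulae φ)) := hfin.powerset
  obtain ⟨C, hC⟩ := exists_buchiAutomaton_of_generalized
    (S := B.State × 𝒫 (subformulae φ)) (ι := Option (subformulae φ))
    (fun s a s' => (s.1, a, s'.1) ∈ B.trans ∧
      ∀ χ ∈ subformulae φ, LocallyConsistent s.2.1 a s'.2.1 χ)
    {s | s.1 ∈ B.init ∧ φ ∈ s.2.1}
    -- Index `none` carries the acceptance of `B`, index `some χ` the fulfilment of `χ`.
    (fun k => {s | k.elim (s.1 ∈ B.recurrent) fun χ => Fulfilled s.2.1 χ})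
  refine ⟨C, fun π => (hC π).trans ⟨?_, ?_⟩⟩
  · rintro ⟨q, h0, ht, hr⟩
    refine ⟨⟨fun i => (q i).1, h0.1, fun i => (ht i).1,
      Nat.frequently_atTop_iff_infinite.1 (hr none)⟩, ?_⟩
    have := mem_iff_sat_of_locallyConsistent (T := fun i => (q i).2.1) (fun i => (ht i).2)
      (fun χ hχ => hr (some ⟨χ, hχ⟩)) φ subset_rfl 0
    rw [Trace.suffix_zero] at this
    exact this.1 h0.2
  · rintro ⟨⟨q, h0, ht, hr⟩, hφ⟩
    refine ⟨fun i => (q i, ⟨{χ | χ ∈ subformulae φ ∧ Sat χ (Trace.suffix π i)}, fun _ h => h.1⟩),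
      ⟨h0, self_mem_subformulae φ, by rwa [Trace.suffix_zero]⟩,
      fun i => ⟨ht i, fun χ hχ => locallyConsistent_sat π hχ i⟩, ?_⟩
    rintro (_ | ⟨χ, hχ⟩)
    · exact Nat.frequently_atTop_iff_infinite.2 hr
    · exact frequently_fulfilled_sat π hχ

end Tableau

/-! ### Lasso-shaped Kripke structures inside Büchi languages -/

section Lasso

variable {AP : Type u}

/-- The position after `n` steps on the lasso that returns from `j - 1` to `i`. -/
def lassoIndex (i j : ℕ) : ℕ → ℕ
  | 0 => 0
  | n + 1 => if lassoIndex i j n + 1 < j then lassoIndex i j n + 1 else i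

theorem lassoIndex_lt {i j : ℕ} (hij : i < j) (n : ℕ) : lassoIndex i j n < j := by
  induction n with
  | zero => exact Nat.zero_lt_of_lt hij
  | succ n ih =>
    rw [lassoIndex]
    split_ifs with h
    · exact h
    · exact hij

theorem frequently_lassoIndex_eq {i j : ℕ} (hij : i < j) :
    ∃ᶠ n in atTop, lassoIndex i j n = i := by
  rw [frequently_atTop]
  intro N
  by_contra! h
  have hd : ∀ d, lassoIndex i j (N + d) = lassoIndex i j N + d := by
    intro d
    induction d with
    | zero => rfl
    | succ d ih =>
      have hne := h (N + d + 1) (by omega)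
      rw [lassoIndex] at hne
      rw [← add_assoc, lassoIndex]
      split_ifs at hne ⊢ with hlt
      · omega
      · exact absurd rfl hne
  have := lassoIndex_lt hij (N + j)
  rw [hd] at this
  omega

/-- Every nonempty Büchi language contains all traces of some Kripke structure. -/
theorem exists_kripkeStructure_traces_subset (B : BuchiAutomaton (Set AP))
    (hB : B.language.Nonempty) :
    ∃ M : KripkeStructure AP, M.traces.Nonempty ∧ M.traces ⊆ B.language := by
  have := B.finite_state
  obtain ⟨x, q, h0, ht, hr⟩ := hB
  -- Pigeonhole: some recurrent state repeats, and the loop is closed there.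
  obtain ⟨i, hi, j, hj, hij, hq⟩ : ∃ i ∈ {i | q i ∈ B.recurrent}, ∃ j ∈ {i | q i ∈ B.recurrent},
      i < j ∧ q i = q j :=
    hr.exists_lt_map_eq_of_mapsTo (Set.mapsTo_univ _ _) Set.finite_univ
  let f := lassoIndex i j
  have hf := lassoIndex_lt hij
  have hfs : ∀ n, f (n + 1) = if f n + 1 < j then f n + 1 else i := fun _ => rfl
  -- The structure is deterministic, so the lasso word is its only trace.
  let M : KripkeStructure AP := {
    State := Fin j
    finite_state := inferInstance
    init := {s | s.1 = 0}
    init_nonempty := ⟨⟨0, by omega⟩, rfl⟩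
    trans := fun s s' => s'.1 = if s.1 + 1 < j then s.1 + 1 else i
    trans_total := fun s => ⟨⟨if s.1 + 1 < j then s.1 + 1 else i, by split_ifs <;> omega⟩, rfl⟩
    label := fun s => x s.1 }
  refine ⟨M, ⟨fun n => x (f n), fun n => ⟨f n, hf n⟩, rfl, fun n => hfs n, fun _ => rfl⟩, ?_⟩
  rintro π ⟨s, hs0, hst, hπ⟩
  have hsf : ∀ n, (s n).1 = f n := by
    intro n
    induction n with
    | zero => exact hs0
    | succ n ih =>
      have := hst n
      change (s (n + 1)).1 = if (s n).1 + 1 < j then (s n).1 + 1 else i at this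
      rw [this, ih, hfs]
  refine ⟨fun n => q (f n), h0, fun n => ?_, Nat.frequently_atTop_iff_infinite.1 ?_⟩
  · have hπn : π n = x (f n) := by rw [hπ, ← hsf]
    have hqn : q (f (n + 1)) = q (f n + 1) := by
      rw [hfs]
      split_ifs with h
      · rfl
      · rw [hq, show f n + 1 = j by have : f n < j := hf n; omega]
    change (q (f n), π n, q (f (n + 1))) ∈ B.trans
    rw [hπn, hqn]
    exact ht _
  · refine (frequently_lassoIndex_eq hij).mono fun n hn => ?_
    change q (lassoIndex i j n) ∈ _
    rw [hn]
    exact hi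

theorem exists_kripkeStructure_of_sat {B : BuchiAutomaton (Set AP)} {φ : Formula AP}
    {π : Trace AP} (hπ : π ∈ B.language) (hφ : Sat φ π) :
    ∃ M : KripkeStructure AP, M.traces.Nonempty ∧ ∀ ρ ∈ M.traces, ρ ∈ B.language ∧ Sat φ ρ := by
  obtain ⟨C, hC⟩ := exists_buchiAutomaton_inter_sat B φ
  obtain ⟨M, hM, hMC⟩ := exists_kripkeStructure_traces_subset C ⟨π, (hC π).2 ⟨hπ, hφ⟩⟩
  exact ⟨M, hM, fun ρ hρ => (hC ρ).1 (hMC hρ)⟩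

end Lasso

/-! ### Kripke consequence versus trace satisfaction -/

section Consequence

variable {AP : Type u}

theorem subset_Cn (X : Set (Formula AP)) : X ⊆ Cn X := fun φ hφ _ hM => hM φ hφ

theorem Cn_mono {X Y : Set (Formula AP)} (h : X ⊆ Y) : Cn X ⊆ Cn Y :=
  fun _ hφ M hM => hφ M fun χ hχ => hM χ (h hχ)

theorem mem_Cn_of_equivalent {φ ψ : Formula AP} (h : Equivalent φ ψ) {X : Set (Formula AP)}
    (hφ : φ ∈ Cn X) : ψ ∈ Cn X := by
  intro M hM
  have hψ : ψ ∈ Cn {φ} := by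
    rw [show Cn {φ} = Cn {ψ} from h]
    exact subset_Cn _ rfl
  refine hψ M fun χ hχ => ?_
  rw [Set.mem_singleton_iff.1 hχ]
  exact hφ M hM

theorem isTautology_iff_of_equivalent {φ ψ : Formula AP} (h : Equivalent φ ψ) :
    IsTautology φ ↔ IsTautology ψ :=
  ⟨mem_Cn_of_equivalent h, mem_Cn_of_equivalent h.symm⟩

/-- A trace of `B` satisfying `φ ∧ ¬χ` would yield a Kripke structure with at least one trace, all
of them of that kind, refuting the consequence. -/
theorem sat_of_mem_Cn_union {B : BuchiAutomaton (Set AP)} {φ χ : Formula AP}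
    (h : χ ∈ Cn (support B ∪ {φ})) {π : Trace AP} (hπ : π ∈ B.language) (hφ : Sat φ π) :
    Sat χ π := by
  by_contra hχ
  obtain ⟨M, ⟨ρ, hρ⟩, hM⟩ := exists_kripkeStructure_of_sat
    (φ := .neg (.or (.neg φ) χ)) hπ (by simp [Sat, hφ, hχ])
  have hsat : ∀ σ ∈ M.traces, Sat φ σ ∧ ¬ Sat χ σ := fun σ hσ => by
    simpa [Sat] using (hM σ hσ).2
  refine (hsat ρ hρ).2 (h M ?_ ρ hρ)
  rintro θ (hθ | rfl) σ hσ
  · exact hθ σ (hM σ hσ).1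
  · exact (hsat σ hσ).1

theorem Cn_support (B : BuchiAutomaton (Set AP)) : Cn (support B) = support B := by
  refine Set.Subset.antisymm (fun χ hχ π hπ => ?_) (subset_Cn _)
  exact sat_of_mem_Cn_union (φ := .neg .falsum) (Cn_mono Set.subset_union_left hχ) hπ
    (fun h => h)

theorem sat_of_equivalent {φ ψ : Formula AP} (h : Equivalent φ ψ) {π : Trace AP}
    (hφ : Sat φ π) : Sat ψ π := by
  obtain ⟨U, hU⟩ := exists_buchiAutomaton_univ (Set AP)
  exact sat_of_mem_Cn_union (B := U)
    (mem_Cn_of_equivalent h (subset_Cn _ (Or.inr rfl))) (hU ▸ Set.mem_univ π) hφ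

theorem inter_support_mem_buchiExcerpt (B C : BuchiAutomaton (Set AP)) :
    support B ∩ support C ∈ buchiExcerpt AP := by
  obtain ⟨D, hD⟩ := exists_buchiAutomaton_union B C
  refine ⟨D, ?_⟩
  ext φ
  simp only [support, hD, Set.mem_inter_iff, Set.mem_ofPred_eq, Set.mem_union, or_imp, forall_and]

end Consequence

/-! ### Rational and Büchi contractions -/

section Contraction

variable {AP : Type u}

theorem inducedContraction_mem_buchiExcerpt {K : Set (Formula AP)} (hK : K ∈ buchiExcerpt AP)
    (γ : Formula AP → BuchiAutomaton (Set AP)) (φ : Formula AP) :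
    inducedContraction K γ φ ∈ buchiExcerpt AP := by
  rw [inducedContraction]
  split_ifs
  · obtain ⟨B, rfl⟩ := hK
    exact inter_support_mem_buchiExcerpt B _
  · exact hK

theorem Cn_of_mem_buchiExcerpt {K : Set (Formula AP)} (hK : K ∈ buchiExcerpt AP) : Cn K = K := by
  obtain ⟨B, rfl⟩ := hK
  exact Cn_support B

theorem IsBuchiChoiceFunction.isRationalContraction {K : Set (Formula AP)}
    (hK : K ∈ buchiExcerpt AP) {γ : Formula AP → BuchiAutomaton (Set AP)}
    (hγ : IsBuchiChoiceFunction γ) : IsRationalContraction K (inducedContraction K γ) where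
  closure φ := (Cn_of_mem_buchiExcerpt (inducedContraction_mem_buchiExcerpt hK γ φ)).symm
  inclusion φ := by
    rw [inducedContraction]
    split_ifs
    · exact Set.inter_subset_left
    · exact subset_rfl
  vacuity φ hφ := if_neg fun h => hφ h.2
  success φ hφ := by
    rw [inducedContraction]
    split_ifs with h
    · rintro ⟨-, hs⟩
      obtain ⟨π, hπ⟩ := hγ.nonempty φ
      exact hγ.supports_neg φ hφ π hπ (hs π hπ)
    · exact fun hK => h ⟨hφ, hK⟩
  recovery φ := by
    rw [inducedContraction]
    split_ifs with h
    · intro χ hχ M hM π hπ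
      have himp : Formula.or (.neg φ) χ ∈ K ∩ support (γ φ) := by
        refine ⟨?_, fun ρ hρ => Or.inl (hγ.supports_neg φ h.1 ρ hρ)⟩
        obtain ⟨B, rfl⟩ := hK
        exact fun ρ hρ => Or.inr (hχ ρ hρ)
      exact (hM _ (Or.inl himp) π hπ).resolve_left
        fun hn => hn (hM φ (Or.inr rfl) π hπ)
    · exact Set.subset_union_left.trans (subset_Cn _)
  extensionality φ ψ h := by
    classical
    have hmem : φ ∈ K ↔ ψ ∈ K := by
      rw [← Cn_of_mem_buchiExcerpt hK]
      exact ⟨mem_Cn_of_equivalent h, mem_Cn_of_equivalent h.symm⟩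
    have hsupp : support (γ φ) = support (γ ψ) := by
      rw [support, support, hγ.extensional φ ψ h]
    rw [inducedContraction, inducedContraction, hsupp]
    exact if_congr (and_congr (not_congr (isTautology_iff_of_equivalent h)) hmem) rfl rfl

/-- Adding a tautology to `c φ` is idle, so recovery already puts `K` inside `c φ`. -/
theorem IsRationalContraction.eq_of_isTautology {K : Set (Formula AP)}
    {c : Formula AP → Set (Formula AP)} (hc : IsRationalContraction K c) {φ : Formula AP}
    (hφ : IsTautology φ) : c φ = K := by
  refine (hc.inclusion φ).antisymm fun χ hχ => ?_
  rw [hc.closure φ]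
  intro M hM
  refine hc.recovery φ hχ M ?_
  rintro θ (hθ | rfl)
  · exact hM θ hθ
  · exact hφ M fun _ h => absurd h (Set.notMem_empty _)

theorem IsRationalContraction.isBuchiContractionFunction {K : Set (Formula AP)}
    {c : Formula AP → Set (Formula AP)} (hc : IsRationalContraction K c)
    (hr : RemainsIn c (buchiExcerpt AP)) : IsBuchiContractionFunction K c := by
  classical
  obtain ⟨U, hU⟩ := exists_buchiAutomaton_univ (Set AP)
  have : Nonempty (BuchiAutomaton (Set AP)) := ⟨U⟩
  choose inter hinter using exists_buchiAutomaton_inter_sat (AP := AP)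
  -- The automaton is chosen from the theory, not the formula, so equivalent formulae receive the
  -- same one.
  let b : Set (Formula AP) → BuchiAutomaton (Set AP) := Function.invFun support
  have hb : ∀ φ, support (b (c φ)) = c φ := fun φ => Function.invFun_eq (hr ⟨φ, rfl⟩)
  let γ : Formula AP → BuchiAutomaton (Set AP) :=
    -- For a tautology no trace violates `φ`; the universal automaton keeps the language nonempty.
    fun φ => if IsTautology φ then U else inter (b (c φ)) φ.neg
  have hpos : ∀ φ, IsTautology φ → γ φ = U := fun φ h => if_pos h
  have hneg : ∀ φ, ¬ IsTautology φ → ∀ π, π ∈ (γ φ).language ↔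
      π ∈ (b (c φ)).language ∧ ¬ Sat φ π := by
    intro φ h π
    rw [show γ φ = _ from if_neg h]
    exact hinter _ _ _
  refine ⟨γ, ⟨fun φ => ?_, fun φ h π hπ => ((hneg φ h π).1 hπ).2, fun φ ψ h => ?_⟩, ?_⟩
  · by_cases h : IsTautology φ
    · rw [hpos φ h, hU]
      exact Set.univ_nonempty
    · have hs := hc.success φ h
      rw [← hb φ] at hs
      simp only [support, Set.mem_ofPred_eq, not_forall] at hs
      obtain ⟨π, hπ, hφ⟩ := hs
      exact ⟨π, (hneg φ h π).2 ⟨hπ, hφ⟩⟩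
  · by_cases hφ : IsTautology φ
    · rw [hpos φ hφ, hpos ψ ((isTautology_iff_of_equivalent h).1 hφ)]
    · ext π
      have hsat : Sat φ π ↔ Sat ψ π := ⟨sat_of_equivalent h, sat_of_equivalent h.symm⟩
      rw [hneg φ hφ, hneg ψ fun hψ => hφ ((isTautology_iff_of_equivalent h).2 hψ),
        hc.extensionality φ ψ h, hsat]
  · funext φ
    rw [inducedContraction]
    split_ifs with h
    · refine Set.Subset.antisymm (fun χ hχ => ⟨hc.inclusion φ hχ, fun π hπ => ?_⟩) ?_
      · rw [← hb φ] at hχ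
        exact hχ π ((hneg φ h.1 π).1 hπ).1
      · rintro χ ⟨hχK, hχ⟩
        have hrec := hc.recovery φ hχK
        rw [← hb φ] at hrec ⊢
        intro π hπ
        by_cases hφ : Sat φ π
        · exact sat_of_mem_Cn_union hrec hπ hφ
        · exact hχ π ((hneg φ h.1 π).2 ⟨hπ, hφ⟩)
    · by_cases hφ : IsTautology φ
      · exact hc.eq_of_isTautology hφ
      · exact hc.vacuity φ fun hK => h ⟨hφ, hK⟩

end Contraction

end BuchiLTL

theorem mainTheorem3 {AP : Type*} [Finite AP] [Nonempty AP]
    (K : Set (BuchiLTL.Formula AP)) (hK : K ∈ BuchiLTL.buchiExcerpt AP)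
    (c : BuchiLTL.Formula AP → Set (BuchiLTL.Formula AP)) :
    (BuchiLTL.IsRationalContraction K c ∧
        BuchiLTL.RemainsIn c (BuchiLTL.buchiExcerpt AP)) ↔
      BuchiLTL.IsBuchiContractionFunction K c := by
  constructor
  · rintro ⟨hc, hr⟩
    exact hc.isBuchiContractionFunction hr
  · rintro ⟨γ, hγ, rfl⟩
    refine ⟨hγ.isRationalContraction hK, ?_⟩
    rintro _ ⟨φ, rfl⟩
    exact BuchiLTL.inducedContraction_mem_buchiExcerpt hK γ φ
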